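/- Let $m,n\ge 2$. Let $G=K_m\,\square\,P_n$ be the Cartesian product of the complete graph $K_m$ and the path graph $P_n$: its vertices are the pairs $(i,j)$ with $0\le i\le m-1$ and $0\le j\le n-1$, and two distinct vertices $(i_1,j_1)$, $(i_2,j_2)$ are adjacent if and only if $j_1=j_2$, or $i_1=i_2$ and $|j_1-j_2|=1$. Let $\Delta=\Delta_2^t(G)$ be the total $2$-cut complex of $G$, that is, the simplicial complex whose facets are the sets $\sigma\subseteq V(G)$ with $|\sigma|=|V(G)|-2$ such that the induced subgraph $G[V(G)\setminus\sigma]$ has no edge (the empty set is counted as a face of $\Delta$). Then the geometric realization of $\Delta$ is homotopy equivalent to a wedge of spheres of dimension $mn-4$: $$\Delta_2^t(K_m\,\square\,P_n)\;\simeq\;\bigvee_{(m-1)(n-1)}\mathbb S^{mn-4}.$$ Moreover, put $\mathcal C_0=\Delta$ and, for $0\le j\le n-1$, let $$\mathcal M_{j}=\bigl\{\{\sigma\setminus\{(0,j)\},\,\sigma\cup\{(0,j)\}\}\;:\;\sigma\setminus\{(0,j)\}\in\mathcal C_j \text{ and } \sigma\cup\{(0,j)\}\in\mathcal C_j\bigr\},$$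 and let $\mathcal C_{j+1}$ be the set of those $\sigma\in\mathcal C_j$ that lie in no pair of $\mathcal M_j$. Let $\mathcal M=\bigcup_{j=0}^{n-1}\mathcal M_j$. Then the critical faces of $\mathcal M$, i.e. the faces of $\Delta$ that lie in no pair of $\mathcal M$, are exactly the sets $\sigma\subseteq V(G)$ with $$V(G)\setminus\sigma=\{(0,0),\,(i,j-1),\,(i,j)\}\quad\text{for some } 1\le i\le m-1,\ 1\le j\le n-1.$$ -/

import Mathlib

namespace TotalCut

/-- A finite abstract simplicial complex with simplices among the finite subsets of `V`: a family of
finite sets closed under passing to subsets. The empty face is a simplex unless the complex is void,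
and not every element of `V` has to be a vertex. -/
abbrev Complex (V : Type*) : Type _ := LowerSet (Finset V)

/-- The geometric realization of a complex with simplices in the finite set `V`, as a subspace of
`V → ℝ`: points of the standard simplex (barycentric coordinates) supported on a simplex. -/
def realization {V : Type*} [Fintype V] (Δ : Complex V) : Set (V → ℝ) :=
  {x | x ∈ stdSimplex ℝ V ∧ ∃ σ ∈ Δ, ∀ v, x v ≠ 0 → v ∈ σ}

/-- The total `k`-cut complex of `G`: its facets are the sets `σ` of `|V| - k` vertices such that
the subgraph induced on the complement of `σ` has no edge. -/
def totalCutComplex {V : Type*} [Fintype V] [DecidableEq V] (k : ℕ) (G : SimpleGraph V) :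
    Complex V :=
  lowerClosure {σ : Finset V | σ.card + k = Fintype.card V ∧ G.IsIndepSet (↑(σᶜ) : Set V)}

/-- `K_m □ P_n`, on the vertices `(i, j)` with `0 ≤ i ≤ m - 1` and `0 ≤ j ≤ n - 1`. -/
def completeBoxPath (m n : ℕ) : SimpleGraph (Fin m × Fin n) :=
  (⊤ : SimpleGraph (Fin m)).boxProd (SimpleGraph.pathGraph n)

section Matching

variable {X : Type*}

/-- A set is matched in a family `M` of pairs if it belongs to some pair of `M`. -/
def IsMatched (M : Set (Sym2 (Finset X))) (σ : Finset X) : Prop :=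
  ∃ e ∈ M, σ ∈ e

/-- The members of `S` that are critical (unmatched) with respect to `M`. -/
def critical (S : Set (Finset X)) (M : Set (Sym2 (Finset X))) : Set (Finset X) :=
  {σ | σ ∈ S ∧ ¬ IsMatched M σ}

variable [DecidableEq X]

/-- The complete element matching on `S` using `x`: all pairs `{σ \ {x}, σ ∪ {x}}` with both
members in `S`. -/
def elementMatching (S : Set (Finset X)) (x : X) : Set (Sym2 (Finset X)) :=
  {e | ∃ σ : Finset X, σ.erase x ∈ S ∧ insert x σ ∈ S ∧ e = s(σ.erase x, insert x σ)}

/-- The families `C_0 = S`, and `C_{i+1}`, what the element matching on `C_i` using `x_i` leaves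
unmatched in `C_i`, for `0 ≤ i < n` (constant from `C_n` on). -/
def remaining {n : ℕ} (S : Set (Finset X)) (x : Fin n → X) : ℕ → Set (Finset X)
  | 0 => S
  | i + 1 => {σ | σ ∈ remaining S x i ∧
      ∀ h : i < n, ¬ IsMatched (elementMatching (remaining S x i) (x ⟨i, h⟩)) σ}

/-- The union of the element matchings on `C_i` using `x_i`, for `0 ≤ i < n`. -/
def sequenceMatching {n : ℕ} (S : Set (Finset X)) (x : Fin n → X) : Set (Sym2 (Finset X)) :=
  ⋃ i : Fin n, elementMatching (remaining S x i) (x i)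

end Matching

section Wedge

variable {ι : Type*} (X : ι → Type*) (p : ∀ i, X i)

/-- The gluing that identifies each base point `p i` with one extra point. -/
inductive WedgeRel : Unit ⊕ (Σ i, X i) → Unit ⊕ (Σ i, X i) → Prop
  | glue (i : ι) : WedgeRel (Sum.inl ()) (Sum.inr ⟨i, p i⟩)

/-- The wedge of the pointed spaces `(X i, p i)`: their disjoint union with all base points
identified (a point if there are no spaces). -/
def Wedge : Type _ := Quot (WedgeRel X p)

instance [∀ i, TopologicalSpace (X i)] : TopologicalSpace (Wedge X p) :=
  inferInstanceAs (TopologicalSpace (Quot (WedgeRel X p)))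

end Wedge

/-- The unit sphere of dimension `d`. -/
abbrev UnitSphere (d : ℕ) : Type :=
  Metric.sphere (0 : EuclideanSpace ℝ (Fin (d + 1))) 1

/-- The base point `(1, 0, …, 0)` of the sphere. -/
noncomputable def spherePoint (d : ℕ) : UnitSphere d :=
  ⟨EuclideanSpace.single 0 1, by simp⟩

/-- The wedge of `r` spheres of dimension `d`. -/
abbrev WedgeOfSpheres (r d : ℕ) : Type :=
  Wedge (fun _ : Fin r => UnitSphere d) (fun _ => spherePoint d)

end TotalCut

/-!
A set `σ` of vertices is a face of the total 2-cut complex exactly if its complement is not a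
clique, so the faces are best read on complements. Write `o = (0, 0)`. The matching using `o`
leaves the faces whose complement is `{o} ∪ K` for a clique `K` that is not contained in the
neighbourhood of `o`. The predicate `Survives` describes the cliques `K` for which this face is
still unmatched after the vertices `(0, 0), …, (0, k)` have been used; toggling `(0, k + 1)` pairs
off the cliques in column `k + 1` and the cliques `{(0, k + 2)}` and `{(0, k + 1), (0, k + 2)}`
(`survives_succ_iff`). In the end only the pairs of consecutive vertices in a row other than row
`0` are left, and these give the critical faces (`mem_remaining_last`).

Among cliques, `Survives` is closed under enlargement. Hence the star of `o` together with the
faces that are still unmatched is a subcomplex (`unmatchedComplex`), and each matching after the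
first one collapses such a subcomplex onto the next (`homotopyEquiv_of_toggle`). An elementary
collapse is realized by an explicit homotopy in barycentric coordinates.

So the total 2-cut complex is homotopy equivalent to the star of `o`, which is a cone, with the
critical faces attached. They all have dimension `mn - 4`, and their boundaries lie in the star
(`IsStarWithCells`). A deformation of this complex contracts the star to `o`
(`IsStarWithCells.contraction`), so that passing to the quotient by the star is a homotopy
equivalence (`homotopyEquiv_range_of_contraction`). The quotient is a wedge of spheres, one for
each critical face: collapsing the complement of an open simplex gives a sphere, and all these
collapses together map the complex onto the wedge, viewed inside the product of its summands
(`IsStarWithCells.homotopyEquiv_wedge`).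
-/

namespace TotalCut

/-! ### Collapses of geometric realizations -/

section Collapse

/-- A subspace onto which a homotopy of the ambient space retracts another subspace, fixing the
former pointwise, is homotopy equivalent to it. -/
theorem homotopyEquiv_of_deformation {E : Type*} [TopologicalSpace E] {A B : Set E} (hAB : A ⊆ B)
    (h : unitInterval × E → E) (hc : Continuous h) (h_zero : ∀ x ∈ B, h (0, x) = x)
    (h_mem : ∀ t, ∀ x ∈ B, h (t, x) ∈ B) (h_one : ∀ x ∈ B, h (1, x) ∈ A)
    (h_fix : ∀ t, ∀ x ∈ A, h (t, x) = x) :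
    Nonempty (ContinuousMap.HomotopyEquiv B A) := by
  let r : C(B, A) := ⟨fun x => ⟨h (1, x), h_one x x.2⟩, by fun_prop⟩
  let i : C(A, B) := ⟨Set.inclusion hAB, continuous_inclusion hAB⟩
  refine ⟨⟨r, i, ContinuousMap.Homotopic.symm ⟨?_⟩, ?_⟩⟩
  · exact
      { toFun := fun p => ⟨h (p.1, p.2), h_mem _ _ p.2.2⟩
        continuous_toFun := by fun_prop
        map_zero_left := fun x => Subtype.ext (h_zero x x.2)
        map_one_left := fun x => rfl }
  · have : r.comp i = ContinuousMap.id A := by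
      ext x
      exact h_fix 1 x x.2
    rw [this]

variable {V : Type*} [Fintype V]

theorem mem_realization_iff {Δ : Complex V} {x : V → ℝ} :
    x ∈ realization Δ ↔ x ∈ stdSimplex ℝ V ∧ Finset.univ.filter (fun v => x v ≠ 0) ∈ Δ := by
  refine and_congr_right fun _ => ⟨?_, fun h => ⟨_, h, by simp⟩⟩
  rintro ⟨σ, hσ, h⟩
  exact Δ.lower (fun v hv => h v (by simpa using hv)) hσ

variable [DecidableEq V]

/-- The elementary collapse of the pair `σ, σ ∪ {y}`. The homotopy moves a point `x` of the simplex
`σ ∪ {y}` along the direction from the barycenter of `σ` to `y`, until a coordinate in `σ`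
vanishes; since it only depends on the minimum of `x` on `σ`, it fixes all other simplices. -/
theorem homotopyEquiv_of_elementary_collapse {Δ Δ' : Complex V} (hle : Δ' ≤ Δ) {σ : Finset V}
    {y : V} (hσ : σ.Nonempty) (hy : y ∉ σ) (hyΔ : insert y σ ∈ Δ) (hσΔ : σ ∉ Δ')
    (hcov : ∀ ρ ∈ Δ, ρ ∈ Δ' ∨ ρ = σ ∨ ρ = insert y σ) :
    Nonempty (ContinuousMap.HomotopyEquiv (realization Δ) (realization Δ')) := by
  let μ : (V → ℝ) → ℝ := fun x => σ.inf' hσ x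
  have hμc : Continuous μ := Continuous.finset_inf'_apply hσ fun i _ => continuous_apply i
  have hμle : ∀ x : V → ℝ, ∀ v ∈ σ, μ x ≤ x v := fun x v hv => Finset.inf'_le _ hv
  have hμ0 : ∀ x ∈ stdSimplex ℝ V, 0 ≤ μ x := fun x hx =>
    Finset.le_inf' _ _ fun v _ => hx.1 v
  let h : unitInterval × (V → ℝ) → V → ℝ := fun p v =>
    p.2 v + p.1 * μ p.2 * ((if v = y then (σ.card : ℝ) else 0) - if v ∈ σ then 1 else 0)
  have hsub : ∀ x ∈ stdSimplex ℝ V, μ x ≠ 0 → ∀ ρ : Finset V, (∀ v, x v ≠ 0 → v ∈ ρ) → σ ⊆ ρ := by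
    intro x hx h0 ρ hρ v hv
    have := hμle x v hv
    have := (hμ0 x hx).lt_of_ne' h0
    exact hρ v (by linarith)
  have hfix : ∀ t, ∀ x ∈ realization Δ, ∀ ρ ∈ Δ', (∀ v, x v ≠ 0 → v ∈ ρ) → h (t, x) = x := by
    intro t x hx ρ hρ hxρ
    have : μ x = 0 := by
      by_contra h0
      exact hσΔ (Δ'.lower (hsub x hx.1 h0 ρ hxρ) hρ)
    ext v
    simp [h, this]
  have hstd : ∀ t, ∀ x ∈ stdSimplex ℝ V, h (t, x) ∈ stdSimplex ℝ V := by
    intro t x hx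
    have h0 := hμ0 x hx
    refine ⟨fun v => ?_, ?_⟩
    · have hv := hx.1 v
      by_cases hvσ : v ∈ σ
      · have hvy : v ≠ y := fun h => hy (h ▸ hvσ)
        have := hμle x v hvσ
        have h1 : (t : ℝ) * μ x ≤ 1 * μ x := mul_le_mul_of_nonneg_right t.2.2 h0
        simp only [h, hvy, hvσ, if_true, if_false]
        linarith
      · have h1 : 0 ≤ (t : ℝ) * μ x := mul_nonneg t.2.1 h0
        have h2 : 0 ≤ if v = y then (σ.card : ℝ) else 0 := by split_ifs <;> positivity
        simp only [h, hvσ, if_false, sub_zero]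
        exact add_nonneg hv (mul_nonneg h1 h2)
    · simp only [h]
      rw [Finset.sum_add_distrib, ← Finset.mul_sum, Finset.sum_sub_distrib, hx.2]
      simp
  have hsupp : ∀ t, ∀ x ∈ realization Δ, μ x ≠ 0 → ∀ v, h (t, x) v ≠ 0 → v ∈ insert y σ := by
    intro t x hx h0 v hv
    rw [mem_realization_iff] at hx
    by_contra hvs
    rw [Finset.mem_insert, not_or] at hvs
    have hsup := hsub x hx.1 h0 _ fun v hv => Finset.mem_filter.2 ⟨Finset.mem_univ v, hv⟩
    have hxv : x v ≠ 0 := by simpa [h, hvs.1, hvs.2] using hv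
    rcases hcov _ hx.2 with h1 | h1 | h1
    · exact hσΔ (Δ'.lower hsup h1)
    · exact hvs.2 (h1 ▸ by simpa using hxv)
    · have : v ∈ insert y σ := h1 ▸ by simpa using hxv
      simp [hvs.1, hvs.2] at this
  refine homotopyEquiv_of_deformation (A := realization Δ') (B := realization Δ) ?_ h ?_ ?_ ?_ ?_ ?_
  · exact fun x hx => ⟨hx.1, hx.2.imp fun ρ hρ => ⟨hle hρ.1, hρ.2⟩⟩
  · refine continuous_pi fun v => ?_
    fun_prop
  · intro x _
    ext v
    simp [h]
  · intro t x hx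
    refine ⟨hstd t x hx.1, ?_⟩
    by_cases h0 : μ x = 0
    · have : h (t, x) = x := by
        ext v
        simp [h, h0]
      rw [this]
      exact hx.2
    · exact ⟨_, hyΔ, hsupp t x hx h0⟩
  · intro x hx
    have hx' := mem_realization_iff.1 hx
    by_cases hxΔ : Finset.univ.filter (fun v => x v ≠ 0) ∈ Δ'
    · rw [hfix 1 x hx _ hxΔ (by simp)]
      exact ⟨hx.1, _, hxΔ, by simp⟩
    · have h0 : μ x ≠ 0 := by
        have hsup : σ ⊆ Finset.univ.filter (fun v => x v ≠ 0) := by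
          rcases hcov _ hx'.2 with h | h | h
          · exact absurd h hxΔ
          · exact h.ge
          · exact h ▸ Finset.subset_insert y σ
        obtain ⟨v, hv, hvμ⟩ := Finset.exists_mem_eq_inf' hσ x
        have : μ x = x v := hvμ
        rw [this]
        simpa using hsup hv
      -- The minimum of `x` on `σ` is attained at `w`, whose coordinate vanishes at time one.
      obtain ⟨w, hw, hwμ⟩ := Finset.exists_mem_eq_inf' hσ x
      have hwy : w ≠ y := fun h => hy (h ▸ hw)
      have hw0 : h (1, x) w = 0 := by
        have : μ x = x w := hwμ
        simp [h, hwy, hw, this]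
      refine ⟨hstd 1 x hx.1, (insert y σ).erase w, ?_, fun v hv => Finset.mem_erase.2
        ⟨fun hvw => hv (hvw ▸ hw0), hsupp 1 x hx h0 v hv⟩⟩
      rcases hcov _ (Δ.lower (Finset.erase_subset w _) hyΔ) with h1 | h1 | h1
      · exact h1
      · exact absurd (h1 ▸ Finset.mem_erase.2 ⟨hwy.symm, Finset.mem_insert_self y σ⟩) hy
      · exact absurd (h1 ▸ Finset.mem_insert_of_mem hw) (Finset.notMem_erase w _)
  · intro t x hx
    obtain ⟨hx1, ρ, hρ, hxρ⟩ := hx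
    exact hfix t x ⟨hx1, ρ, hle hρ, hxρ⟩ ρ hρ hxρ

/-- If the simplices of `Δ` outside a nonvoid subcomplex `Δ'` can be paired off by adding and
removing one vertex `y`, then `Δ` collapses onto `Δ'`. -/
theorem homotopyEquiv_of_toggle {Δ Δ' : Complex V} (hle : Δ' ≤ Δ) (hne : ∅ ∈ Δ') (y : V)
    (htog : ∀ σ ∈ Δ, σ ∉ Δ' → insert y σ ∈ Δ ∧ σ.erase y ∉ Δ') :
    Nonempty (ContinuousMap.HomotopyEquiv (realization Δ) (realization Δ')) := by
  classical
  induction hN : (Finset.univ.filter fun σ => σ ∈ Δ ∧ σ ∉ Δ').card using Nat.strong_induction_on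
    generalizing Δ with
  | _ N ih =>
  by_cases hD : (Finset.univ.filter fun σ => σ ∈ Δ ∧ σ ∉ Δ').Nonempty
  · obtain ⟨ρ, hρ, hmax⟩ := Finset.exists_max_image _ Finset.card hD
    simp only [Finset.mem_filter, Finset.mem_univ, true_and, and_imp] at hρ hmax
    obtain ⟨hρΔ, hρΔ'⟩ := hρ
    have hins : ∀ σ ∈ Δ, σ ∉ Δ' → insert y σ ∈ Δ ∧ insert y σ ∉ Δ' := fun σ h h' =>
      ⟨(htog σ h h').1, fun h'' => h' (Δ'.lower (Finset.subset_insert y σ) h'')⟩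
    have hmax' : ∀ a ∈ Δ, ρ ⊆ a → a = ρ := fun a ha hρa =>
      (Finset.eq_of_subset_of_card_le hρa
        (hmax a ha fun h => hρΔ' (Δ'.lower hρa h))).symm
    have hyρ : y ∈ ρ := by
      rw [← hmax' _ (hins ρ hρΔ hρΔ').1 (Finset.subset_insert y ρ)]
      exact Finset.mem_insert_self y ρ
    have hσΔ' := (htog ρ hρΔ hρΔ').2
    have hy : y ∉ ρ.erase y := Finset.notMem_erase y ρ
    have hiρ : insert y (ρ.erase y) = ρ := Finset.insert_erase hyρ
    have hbtw : ∀ a, insert y a = ρ → a = ρ ∨ a = ρ.erase y := by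
      intro a ha
      by_cases hya : y ∈ a
      · exact .inl (Finset.insert_eq_of_mem hya ▸ ha)
      · exact .inr (by rw [← ha, Finset.erase_insert hya])
    have hup : ∀ a ∈ Δ, ρ.erase y ⊆ a → a = ρ ∨ a = ρ.erase y := by
      intro a ha hρa
      have haΔ' : a ∉ Δ' := fun h => hσΔ' (Δ'.lower hρa h)
      refine hbtw a (hmax' _ (hins a ha haΔ').1 ?_)
      rw [← hiρ]
      exact Finset.insert_subset_insert y hρa
    let Δ₁ : Complex V :=
      { carrier := {a | a ∈ Δ ∧ a ≠ ρ ∧ a ≠ ρ.erase y}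
        lower' := by
          rintro a b hba ⟨ha, haρ, haσ⟩
          refine ⟨Δ.lower hba ha, ?_, ?_⟩
          · rintro rfl
            exact haρ (hmax' a ha hba)
          · rintro rfl
            exact (hup a ha hba).elim haρ haσ }
    have hΔ₁ : ∀ a, a ∈ Δ₁ ↔ a ∈ Δ ∧ a ≠ ρ ∧ a ≠ ρ.erase y := fun a => Iff.rfl
    have hle₁ : Δ' ≤ Δ₁ := fun a ha =>
      ⟨hle ha, fun h => hρΔ' (h ▸ ha), fun h => hσΔ' (h ▸ ha)⟩
    have e₁ : Nonempty (ContinuousMap.HomotopyEquiv (realization Δ) (realization Δ₁)) := by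
      refine homotopyEquiv_of_elementary_collapse (fun a ha => ha.1) (σ := ρ.erase y) (y := y) ?_ hy
        (hiρ.symm ▸ hρΔ) (fun h => h.2.2 rfl) fun a ha => ?_
      · rw [Finset.nonempty_iff_ne_empty]
        exact fun h => hσΔ' (h ▸ hne)
      · rw [hiρ, hΔ₁]
        tauto
    have e₂ : Nonempty (ContinuousMap.HomotopyEquiv (realization Δ₁) (realization Δ')) := by
      refine ih _ ?_ hle₁ (fun a ha haΔ' => ⟨⟨(htog a ha.1 haΔ').1, ?_, ?_⟩, (htog a ha.1 haΔ').2⟩)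
        rfl
      · rw [← hN]
        refine Finset.card_lt_card (Finset.ssubset_iff_of_subset ?_ |>.2 ⟨ρ, ?_, ?_⟩)
        · exact Finset.monotone_filter_right _ fun a _ ha => ⟨ha.1.1, ha.2⟩
        · simp [hρΔ, hρΔ']
        · simp [hΔ₁]
      · exact fun h => (hbtw a h).elim ha.2.1 ha.2.2
      · exact fun h => hy (h ▸ Finset.mem_insert_self y a)
    obtain ⟨e₁⟩ := e₁
    obtain ⟨e₂⟩ := e₂
    exact ⟨e₁.trans e₂⟩
  · have : Δ = Δ' := by
      refine le_antisymm (fun a ha => ?_) hle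
      by_contra h
      exact hD ⟨a, by simpa using ⟨ha, h⟩⟩
    subst this
    exact ⟨ContinuousMap.HomotopyEquiv.refl _⟩

end Collapse

/-! ### Wedges -/

section Wedge

variable {ι : Type*} {X : ι → Type*} (p : ∀ i, X i)

open Classical in
/-- The inclusion of a wedge into the product of its summands: a point of the summand `X i` is
sent to the family with all other coordinates at the base point. -/
noncomputable def wedgeToPi : Wedge X p → ∀ i, X i :=
  Quot.lift (Sum.elim (fun _ => p) fun y => Function.update p y.1 y.2) (by
    rintro _ _ ⟨i⟩
    simp)

theorem wedgeToPi_injective : Function.Injective (wedgeToPi p) := by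
  classical
  have hbase : ∀ i (y : X i), Function.update p i y = p → y = p i := fun i y h => by
    simpa using congrFun h i
  have hglue : ∀ i, (Quot.mk _ (Sum.inr ⟨i, p i⟩) : Wedge X p) = Quot.mk _ (Sum.inl ()) :=
    fun i => (Quot.sound (WedgeRel.glue i)).symm
  rintro ⟨⟨⟩ | ⟨i, y⟩⟩ ⟨⟨⟩ | ⟨j, z⟩⟩ h
  · rfl
  · have hz : z = p j := hbase j z h.symm
    subst hz
    exact (hglue j).symm
  · have hy : y = p i := hbase i y h
    subst hy
    exact hglue i
  · change Function.update p i y = Function.update p j z at h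
    by_cases hij : i = j
    · subst hij
      have := congrFun h i
      simp only [Function.update_self] at this
      rw [this]
    · have hy : y = p i := by
        have := congrFun h i
        rwa [Function.update_self, Function.update_of_ne hij] at this
      have hz : z = p j := by
        have := congrFun h j
        rw [Function.update_self, Function.update_of_ne (Ne.symm hij)] at this
        exact this.symm
      subst hy hz
      exact (hglue i).trans (hglue j).symm

theorem continuous_wedgeToPi [∀ i, TopologicalSpace (X i)] : Continuous (wedgeToPi p) := by
  classical
  refine continuous_quot_lift _
    (continuous_const.sumElim (continuous_sigma fun i => ?_))
  exact continuous_const.update i continuous_id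

instance [Finite ι] [∀ i, TopologicalSpace (X i)] [∀ i, CompactSpace (X i)] :
    CompactSpace (Wedge X p) :=
  inferInstanceAs (CompactSpace (Quot (WedgeRel X p)))

theorem isEmbedding_wedgeToPi [Finite ι] [∀ i, TopologicalSpace (X i)]
    [∀ i, CompactSpace (X i)] [∀ i, T2Space (X i)] : Topology.IsEmbedding (wedgeToPi p) :=
  ((continuous_wedgeToPi p).isClosedEmbedding (wedgeToPi_injective p)).isEmbedding

end Wedge

/-! ### Quotients by contractible subspaces, and collapse maps -/

/-- A quotient map `F` of a compact space that identifies the points of a set `A`, and nothing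
else, is a homotopy equivalence if a deformation of the space keeps `A` inside itself and contracts
it to a point. -/
theorem homotopyEquiv_range_of_contraction {X Y : Type*} [TopologicalSpace X] [TopologicalSpace Y]
    [CompactSpace X] [T2Space Y] {F : X → Y} (hF : Continuous F) {A : Set X}
    (hfib : ∀ x y, F x = F y ↔ x = y ∨ (x ∈ A ∧ y ∈ A))
    (h : unitInterval × X → X) (hc : Continuous h) (h_zero : ∀ x, h (0, x) = x)
    (h_mem : ∀ t, ∀ a ∈ A, h (t, a) ∈ A) (x₀ : X) (h_one : ∀ a ∈ A, h (1, a) = x₀) :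
    Nonempty (ContinuousMap.HomotopyEquiv X (Set.range F)) := by
  let q : C(X, Set.range F) := ⟨Set.rangeFactorization F, by fun_prop⟩
  have hq : Topology.IsQuotientMap q :=
    q.continuous.isClosedMap.isQuotientMap q.continuous Set.rangeFactorization_surjective
  have hqF : ∀ x y, q x = q y → x = y ∨ (x ∈ A ∧ y ∈ A) := fun x y hxy =>
    (hfib x y).1 (congrArg Subtype.val hxy)
  have hqA : ∀ x ∈ A, ∀ y ∈ A, q x = q y := fun x hx y hy =>
    Subtype.ext ((hfib x y).2 (.inr ⟨hx, hy⟩))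
  let h₁ : C(X, X) := ⟨fun x => h (1, x), by fun_prop⟩
  have hfac₁ : Function.FactorsThrough h₁ q := by
    intro x y hxy
    rcases hqF x y hxy with rfl | ⟨hx, hy⟩
    · rfl
    · exact (h_one x hx).trans (h_one y hy).symm
  let g : C(Set.range F, X) := hq.lift h₁ hfac₁
  have hg : ∀ x, g (q x) = h₁ x := fun x => congrArg (fun f : C(X, X) => f x)
    (hq.lift_comp h₁ hfac₁)
  let H : C(X, C(unitInterval, Set.range F)) :=
    ContinuousMap.curry ⟨fun z => q (h (z.2, z.1)), by fun_prop⟩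
  have hfacH : Function.FactorsThrough H q := by
    intro x y hxy
    rcases hqF x y hxy with rfl | ⟨hx, hy⟩
    · rfl
    · ext1 t
      exact hqA _ (h_mem t x hx) _ (h_mem t y hy)
  let H' : C(Set.range F, C(unitInterval, Set.range F)) := hq.lift H hfacH
  have hH' : ∀ x t, H' (q x) t = q (h (t, x)) := fun x t =>
    congrArg (fun f : C(X, C(unitInterval, Set.range F)) => f x t) (hq.lift_comp H hfacH)
  refine ⟨⟨q, g, ContinuousMap.Homotopic.symm ⟨?_⟩, ContinuousMap.Homotopic.symm ⟨?_⟩⟩⟩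
  · exact
      { toFun := h
        continuous_toFun := hc
        map_zero_left := h_zero
        map_one_left := fun x => (hg x).symm }
  · exact
      { toFun := fun z => H' z.2 z.1
        continuous_toFun := by fun_prop
        map_zero_left := fun y => by
          obtain ⟨x, rfl⟩ := hq.surjective y
          change H' (q x) 0 = q x
          rw [hH', h_zero]
        map_one_left := fun y => by
          obtain ⟨x, rfl⟩ := hq.surjective y
          change H' (q x) 1 = q (g (q x))
          rw [hH', hg]
          rfl }

open Classical in
/-- The collapse of the complement of `U` to the point at infinity, for a map `f` that identifies
`U` with `Y`. -/
noncomputable def collapseMap {X Y : Type*} (U : Set X) (f : X → Y) (x : X) : OnePoint Y :=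
  if x ∈ U then (f x : OnePoint Y) else OnePoint.infty

theorem continuous_collapseMap {X Y : Type*} [TopologicalSpace X] [TopologicalSpace Y] [T2Space X]
    {U : Set X} (hU : IsOpen U) {f : X → Y} (hf : ContinuousOn f U) {g : Y → X}
    (hg : Continuous g) (hgU : ∀ y, g y ∈ U) (hgf : ∀ x ∈ U, g (f x) = x)
    (hfg : ∀ y, f (g y) = y) : Continuous (collapseMap U f) := by
  classical
  rw [continuous_def]
  intro s hs
  by_cases h : OnePoint.infty ∈ s
  · rw [OnePoint.isOpen_iff_of_mem h] at hs
    have : collapseMap U f ⁻¹' s = (g '' ((↑) ⁻¹' s : Set Y)ᶜ)ᶜ := by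
      ext x
      simp only [collapseMap, Set.mem_preimage, Set.mem_compl_iff, Set.mem_image, not_exists,
        not_and]
      split_ifs with hx
      · constructor
        · rintro hfx y hy rfl
          exact hy (by rwa [hfg] at hfx)
        · intro hy
          by_contra hfx
          exact hy (f x) hfx (hgf x hx)
      · refine iff_of_true h fun y _ hy => hx (hy ▸ hgU y)
    rw [this]
    exact (hs.2.image hg).isClosed.isOpen_compl
  · rw [OnePoint.isOpen_iff_of_notMem h] at hs
    have : collapseMap U f ⁻¹' s = U ∩ f ⁻¹' ((↑) ⁻¹' s) := by
      ext x
      simp only [collapseMap, Set.mem_preimage, Set.mem_inter_iff]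
      split_ifs with hx
      · simp [hx]
      · simp [hx, h]
    rw [this]
    exact hf.isOpen_inter_preimage hU hs

/-- The sphere is the one-point compactification of Euclidean space, with the point at infinity
placed at the base point (by stereographic projection). -/
theorem exists_onePoint_homeomorph_sphere (d : ℕ) :
    ∃ e : OnePoint (Fin d → ℝ) ≃ₜ UnitSphere d, e OnePoint.infty = spherePoint d := by
  let v : EuclideanSpace ℝ (Fin (d + 1)) := EuclideanSpace.single 0 1
  have hv : ‖v‖ = 1 := by simp [v]
  have hv₀ : v ≠ 0 := fun h => by simp [h] at hv
  have : Fact (Module.finrank ℝ (EuclideanSpace ℝ (Fin (d + 1))) = d + 1) := ⟨by simp⟩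
  have hd : Module.finrank ℝ (Fin d → ℝ) = Module.finrank ℝ (Submodule.span ℝ {v})ᗮ := by
    rw [Submodule.finrank_orthogonal_span_singleton (n := d) hv₀, Module.finrank_fin_fun]
  let e : (Fin d → ℝ) ≃ₜ (Submodule.span ℝ {v})ᗮ :=
    (FiniteDimensional.nonempty_continuousLinearEquiv_of_finrank_eq hd).some.toHomeomorph
  refine ⟨e.onePointCongr.trans (onePointHyperplaneHomeoUnitSphere hv), ?_⟩
  have h₁ : e.onePointCongr OnePoint.infty = OnePoint.infty := rfl
  rw [Homeomorph.trans_apply, h₁, onePointHyperplaneHomeoUnitSphere]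
  exact OnePoint.equivOfIsEmbeddingOfRangeEq_apply_infty ..

/-! ### A cone with cells of equal dimension attached -/

section Star

variable {V ι : Type*} [Fintype V] [DecidableEq V] [Fintype ι]

/-- The complex `Δ` is the union of the star of its vertex `o` and of the distinct `d`-simplices
`s i`, which are not in the star. -/
structure IsStarWithCells (Δ : Complex V) (o : V) (d : ℕ) (s : ι → Finset V) : Prop where
  singleton_mem : {o} ∈ Δ
  injective : Function.Injective s
  mem : ∀ i, s i ∈ Δ
  insert_notMem : ∀ i, insert o (s i) ∉ Δ
  card : ∀ i, (s i).card = d + 1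
  insert_mem_or : ∀ ρ ∈ Δ, insert o ρ ∈ Δ ∨ ∃ i, ρ = s i

namespace IsStarWithCells

variable {Δ : Complex V} {o : V} {d : ℕ} {s : ι → Finset V}

omit [Fintype V] [Fintype ι] in
theorem notMem (hs : IsStarWithCells Δ o d s) (i : ι) : o ∉ s i := fun h =>
  hs.insert_notMem i ((Finset.insert_eq_of_mem h).symm ▸ hs.mem i)

omit [Fintype V] [Fintype ι] in
/-- The cells are facets. -/
theorem eq_of_subset (hs : IsStarWithCells Δ o d s) {i : ι} {ρ : Finset V} (hρ : ρ ∈ Δ)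
    (hi : s i ⊆ ρ) : ρ = s i := by
  rcases hs.insert_mem_or ρ hρ with h | ⟨j, rfl⟩
  · exact absurd (Δ.lower (Finset.insert_subset_insert o hi) h) (hs.insert_notMem i)
  · exact (Finset.eq_of_subset_of_card_le hi (by rw [hs.card, hs.card])).symm

omit [Fintype V] [Fintype ι] in
theorem nonempty (hs : IsStarWithCells Δ o d s) (i : ι) : (s i).Nonempty := by
  rw [← Finset.card_pos, hs.card]
  exact Nat.succ_pos d

/-- The points of the realization whose coordinates on `σ` are positive; for a facet `σ` this is
the open simplex spanned by `σ`. -/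
def openCell (Δ : Complex V) (σ : Finset V) : Set (realization Δ) :=
  {x | ∀ v ∈ σ, 0 < (x : V → ℝ) v}

omit [DecidableEq V] in
theorem isOpen_openCell (σ : Finset V) : IsOpen (openCell Δ σ) := by
  have : openCell Δ σ = ⋂ v ∈ σ, {x : realization Δ | 0 < (x : V → ℝ) v} := by
    ext x
    simp [openCell]
  rw [this]
  exact isOpen_biInter_finset fun v _ => isOpen_lt continuous_const
    ((continuous_apply v).comp continuous_subtype_val)

omit [Fintype ι] in
/-- A point of an open cell is supported on the cell, because the cell is a facet. -/
theorem mem_of_openCell (hs : IsStarWithCells Δ o d s) {i : ι} {x : realization Δ}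
    (hx : x ∈ openCell Δ (s i)) {v : V} (hv : (x : V → ℝ) v ≠ 0) : v ∈ s i := by
  have h := (mem_realization_iff.1 x.2).2
  have := hs.eq_of_subset (i := i) h fun w hw => by simpa using (hx w hw).ne'
  rw [← this]
  simpa using hv

omit [Fintype ι] in
theorem eq_of_openCell (hs : IsStarWithCells Δ o d s) {i j : ι} {x : realization Δ}
    (hi : x ∈ openCell Δ (s i)) (hj : x ∈ openCell Δ (s j)) : i = j :=
  hs.injective ((hs.eq_of_subset (hs.mem j) fun _ hv => hs.mem_of_openCell hj (hi _ hv).ne').symm)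

omit [Fintype ι] in
theorem insert_support_mem (hs : IsStarWithCells Δ o d s) {x : realization Δ}
    (hx : ∀ i, x ∉ openCell Δ (s i)) :
    insert o (Finset.univ.filter fun v => (x : V → ℝ) v ≠ 0) ∈ Δ := by
  have h := mem_realization_iff.1 x.2
  rcases hs.insert_mem_or _ h.2 with h' | ⟨i, hi⟩
  · exact h'
  · refine absurd (fun v hv => ?_) (hx i)
    rw [← hi] at hv
    exact lt_of_le_of_ne (h.1.1 v) (by simpa using hv : (x : V → ℝ) v ≠ 0).symm

/-- The smallest barycentric coordinate on the cell `s i`. It is positive on the open cell, and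
zero elsewhere. -/
noncomputable def depth (hs : IsStarWithCells Δ o d s) (i : ι) (x : V → ℝ) : ℝ :=
  (s i).inf' (hs.nonempty i) x

omit [Fintype V] [Fintype ι] in
theorem continuous_depth (hs : IsStarWithCells Δ o d s) (i : ι) : Continuous (hs.depth i) :=
  Continuous.finset_inf'_apply (hs.nonempty i) fun v _ => continuous_apply v

omit [Fintype ι] in
theorem depth_nonneg (hs : IsStarWithCells Δ o d s) (i : ι) (x : realization Δ) :
    0 ≤ hs.depth i x :=
  Finset.le_inf' _ _ fun v _ => x.2.1.1 v

omit [Fintype ι] in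
theorem depth_pos_iff (hs : IsStarWithCells Δ o d s) (i : ι) (x : realization Δ) :
    0 < hs.depth i x ↔ x ∈ openCell Δ (s i) := by
  simp [depth, openCell, Finset.lt_inf'_iff]

omit [Fintype ι] in
theorem depth_eq_zero (hs : IsStarWithCells Δ o d s) {i : ι} {x : realization Δ}
    (hx : x ∉ openCell Δ (s i)) : hs.depth i x = 0 :=
  le_antisymm (not_lt.1 fun h => hx ((hs.depth_pos_iff i x).1 h)) (hs.depth_nonneg i x)

/-- Half of the barycentric coordinates of the barycenter of a `d`-simplex. Lowering the coordinates
of a cell by at most this amount cannot make all of them vanish. -/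
noncomputable def cutoff (d : ℕ) : ℝ := 1 / (2 * (d + 1))

theorem cutoff_pos (d : ℕ) : 0 < cutoff d := by
  unfold cutoff
  positivity

theorem cutoff_mul (d : ℕ) : (d + 1) * cutoff d = 1 / 2 := by
  unfold cutoff
  field_simp

variable (t : unitInterval) (x : V → ℝ)

/-- The point `x` with `min (t c) (depth x)` subtracted from its coordinates in each cell, where
`c` is the cut-off. -/
noncomputable def lowered (hs : IsStarWithCells Δ o d s) (v : V) : ℝ :=
  x v - ∑ i, if v ∈ s i then min (t * cutoff d) (hs.depth i x) else 0

/-- The weight added to the vertex `o`: it is `t c` on the star of `o`. -/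
noncomputable def apexWeight (hs : IsStarWithCells Δ o d s) : ℝ :=
  t * cutoff d - ∑ i, min (t * cutoff d) (hs.depth i x)

/-- The factor applied to the lowered point: at time one it vanishes exactly on the star of `o`. -/
noncomputable def scaleFactor (hs : IsStarWithCells Δ o d s) : ℝ :=
  1 - t + ∑ i, hs.depth i x

/-- The contraction before its normalization to total weight one. -/
noncomputable def preContraction (hs : IsStarWithCells Δ o d s) (v : V) : ℝ :=
  hs.scaleFactor t x * hs.lowered t x v + if v = o then hs.apexWeight t x else 0

omit [Fintype V] in
theorem continuous_preContraction (hs : IsStarWithCells Δ o d s) (v : V) :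
    Continuous fun p : unitInterval × (V → ℝ) => hs.preContraction p.1 p.2 v := by
  have := hs.continuous_depth
  have h₁ : Continuous fun p : unitInterval × (V → ℝ) => hs.lowered p.1 p.2 v := by
    unfold lowered
    refine Continuous.sub (by fun_prop) (continuous_finsetSum _ fun i _ => ?_)
    split_ifs <;> fun_prop
  have h₂ : Continuous fun p : unitInterval × (V → ℝ) => hs.apexWeight p.1 p.2 := by
    unfold apexWeight
    fun_prop
  have h₃ : Continuous fun p : unitInterval × (V → ℝ) => hs.scaleFactor p.1 p.2 := by
    unfold scaleFactor
    fun_prop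
  unfold preContraction
  split_ifs <;> fun_prop

variable {t} {x : realization Δ}

section OffCells

variable (hs : IsStarWithCells Δ o d s) (hx : ∀ i, x ∉ openCell Δ (s i))
include hx

theorem preContraction_of_notMem (t : unitInterval) (v : V) :
    hs.preContraction t x v = (1 - t) * (x : V → ℝ) v + if v = o then t * cutoff d else 0 := by
  have h : ∀ i, hs.depth i x = 0 := fun i => hs.depth_eq_zero (hx i)
  have h' : min (t * cutoff d) 0 = 0 := min_eq_right (mul_nonneg t.2.1 (cutoff_pos d).le)
  simp [preContraction, scaleFactor, lowered, apexWeight, h, h']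

end OffCells

theorem preContraction_of_mem (hs : IsStarWithCells Δ o d s) {i : ι}
    (hx : x ∈ openCell Δ (s i)) (t : unitInterval) (v : V) :
    hs.preContraction t x v =
      (1 - t + hs.depth i x) *
        ((x : V → ℝ) v - if v ∈ s i then min (t * cutoff d) (hs.depth i x) else 0) +
      if v = o then t * cutoff d - min (t * cutoff d) (hs.depth i x) else 0 := by
  have h : ∀ j, j ≠ i → hs.depth j x = 0 := fun j hj =>
    hs.depth_eq_zero fun h => hj (hs.eq_of_openCell h hx)
  have h' : min (t * cutoff d) 0 = 0 := min_eq_right (mul_nonneg t.2.1 (cutoff_pos d).le)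
  have e₁ : ∑ j, hs.depth j x = hs.depth i x :=
    Finset.sum_eq_single i (fun j _ hj => h j hj) (by simp)
  have e₂ : ∑ j, min (t * cutoff d) (hs.depth j x) = min (t * cutoff d) (hs.depth i x) :=
    Finset.sum_eq_single i (fun j _ hj => by rw [h j hj, h']) (by simp)
  have e₃ : (∑ j, if v ∈ s j then min (t * cutoff d) (hs.depth j x) else 0) =
      if v ∈ s i then min (t * cutoff d) (hs.depth i x) else 0 :=
    Finset.sum_eq_single i (fun j _ hj => by rw [h j hj, h', ite_self]) (by simp)
  rw [preContraction, scaleFactor, lowered, apexWeight, e₁, e₂, e₃]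

theorem preContraction_nonneg (hs : IsStarWithCells Δ o d s) (t : unitInterval) (v : V) :
    0 ≤ hs.preContraction t x v := by
  have hxv := x.2.1.1 v
  have ht := t.2.2
  have htc : 0 ≤ t * cutoff d := mul_nonneg t.2.1 (cutoff_pos d).le
  by_cases hx : ∃ i, x ∈ openCell Δ (s i)
  · obtain ⟨i, hx⟩ := hx
    rw [hs.preContraction_of_mem hx]
    have hd := hs.depth_nonneg i x
    refine add_nonneg (mul_nonneg (by linarith) ?_) ?_
    · split_ifs with hv
      · have h₁ : hs.depth i x ≤ (x : V → ℝ) v := Finset.inf'_le _ hv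
        have h₂ := min_le_right (t * cutoff d) (hs.depth i x)
        linarith
      · simpa using hxv
    · split_ifs
      · linarith [min_le_left (t * cutoff d) (hs.depth i x)]
      · exact le_rfl
  · rw [hs.preContraction_of_notMem (not_exists.1 hx)]
    refine add_nonneg (mul_nonneg (by linarith) hxv) ?_
    split_ifs <;> positivity

theorem sum_preContraction_pos (hs : IsStarWithCells Δ o d s) (t : unitInterval) :
    0 < ∑ v, hs.preContraction t x v := by
  have hsum : ∑ v, (x : V → ℝ) v = 1 := x.2.1.2
  have ht := t.2.2
  have hc := cutoff_pos d
  by_cases hx : ∃ i, x ∈ openCell Δ (s i)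
  · obtain ⟨i, hx⟩ := hx
    simp only [hs.preContraction_of_mem hx]
    rw [Finset.sum_add_distrib, ← Finset.mul_sum, Finset.sum_sub_distrib, hsum]
    simp only [Finset.sum_ite_eq', Finset.mem_univ, if_true, Finset.sum_ite_mem,
      Finset.univ_inter, Finset.sum_const, hs.card, nsmul_eq_mul]
    have hd := (hs.depth_pos_iff i x).2 hx
    have h₁ := min_le_left (t * cutoff d) (hs.depth i x)
    have h₂ : t * cutoff d ≤ 1 * cutoff d := mul_le_mul_of_nonneg_right ht hc.le
    have h₃ := cutoff_mul d
    have h₄ : ((d + 1 : ℕ) : ℝ) * min (t * cutoff d) (hs.depth i x) ≤ 1 / 2 := by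
      rw [← h₃]
      push_cast
      exact mul_le_mul_of_nonneg_left (by linarith) (by positivity)
    exact add_pos_of_pos_of_nonneg (mul_pos (by linarith) (by linarith)) (by linarith)
  · simp only [hs.preContraction_of_notMem (not_exists.1 hx)]
    rw [Finset.sum_add_distrib, ← Finset.mul_sum, hsum]
    simp only [Finset.sum_ite_eq', Finset.mem_univ, if_true]
    rcases ht.lt_or_eq with h | h
    · have := mul_nonneg t.2.1 hc.le
      linarith
    · rw [h]
      linarith

theorem exists_mem_support_preContraction (hs : IsStarWithCells Δ o d s) (t : unitInterval) :
    ∃ σ ∈ Δ, ∀ v, hs.preContraction t x v ≠ 0 → v ∈ σ := by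
  by_cases hx : ∃ i, x ∈ openCell Δ (s i)
  · obtain ⟨i, hx⟩ := hx
    simp only [hs.preContraction_of_mem hx]
    rcases le_total (t * cutoff d) (hs.depth i x) with h | h
    · refine ⟨s i, hs.mem i, fun v hv => ?_⟩
      by_contra hvi
      have : (x : V → ℝ) v = 0 := by
        by_contra h0
        exact hvi (hs.mem_of_openCell hx h0)
      simp [min_eq_left h, hvi, this] at hv
    · -- The smallest coordinate in the cell becomes zero, so the point lies over the boundary.
      obtain ⟨w, hw, hwd⟩ := Finset.exists_mem_eq_inf' (hs.nonempty i) (x : V → ℝ)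
      have hwd : hs.depth i x = (x : V → ℝ) w := hwd
      have hwo : w ≠ o := fun h => hs.notMem i (h ▸ hw)
      refine ⟨insert o ((s i).erase w), ?_, fun v hv => ?_⟩
      · rcases hs.insert_mem_or _ (Δ.lower (Finset.erase_subset w _) (hs.mem i)) with h' | ⟨j, hj⟩
        · exact h'
        · have h₁ := hs.card i
          have h₂ := hs.card j
          rw [← hj, Finset.card_erase_of_mem hw] at h₂
          omega
      · by_contra hvi
        rw [Finset.mem_insert, not_or, Finset.mem_erase, not_and] at hvi
        by_cases hvw : v = w
        · subst hvw
          rw [hwd] at h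
          simp [min_eq_right h, hw, hwo, hwd] at hv
        · have : (x : V → ℝ) v = 0 := by
            by_contra h0
            exact hvi.2 hvw (hs.mem_of_openCell hx h0)
          simp [hvi.1, hvi.2 hvw, this] at hv
  · refine ⟨_, hs.insert_support_mem (not_exists.1 hx), fun v hv => ?_⟩
    by_contra hvi
    simp only [Finset.mem_insert, not_or, Finset.mem_filter, Finset.mem_univ, true_and,
      not_not] at hvi
    simp [hs.preContraction_of_notMem (not_exists.1 hx), hvi] at hv

/-- The star of `o` can be contracted to `o` by a deformation of the whole complex: the part of each
cell near its boundary is dragged into the cone over the boundary, and the rest is stretched over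
the cell. -/
noncomputable def contraction (hs : IsStarWithCells Δ o d s)
    (p : unitInterval × realization Δ) : realization Δ :=
  ⟨fun v => hs.preContraction p.1 p.2 v / ∑ w, hs.preContraction p.1 p.2 w,
    ⟨fun v => div_nonneg (hs.preContraction_nonneg _ _) (hs.sum_preContraction_pos _).le, by
      rw [← Finset.sum_div, div_self (hs.sum_preContraction_pos _).ne']⟩, by
    obtain ⟨σ, hσ, h⟩ := hs.exists_mem_support_preContraction (x := p.2) p.1
    exact ⟨σ, hσ, fun v hv => h v fun h0 => hv (by simp [h0])⟩⟩

theorem continuous_contraction (hs : IsStarWithCells Δ o d s) : Continuous hs.contraction := by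
  have h : ∀ v, Continuous fun p : unitInterval × realization Δ =>
      hs.preContraction p.1 p.2 v := fun v =>
    (hs.continuous_preContraction v).comp (by fun_prop :
      Continuous fun p : unitInterval × realization Δ => (p.1, (p.2 : V → ℝ)))
  refine Continuous.subtype_mk (continuous_pi fun v => (h v).div ?_ fun p => ?_) _
  · exact continuous_finsetSum _ fun w _ => h w
  · exact (hs.sum_preContraction_pos _).ne'

theorem contraction_zero (hs : IsStarWithCells Δ o d s) (x : realization Δ) :
    hs.contraction (0, x) = x := by
  have hsum : ∑ v, (x : V → ℝ) v = 1 := x.2.1.2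
  have h : ∀ v, hs.preContraction 0 x v = (1 + ∑ i, hs.depth i x) * (x : V → ℝ) v := by
    intro v
    have : ∀ i, min 0 (hs.depth i x) = 0 := fun i => min_eq_left (hs.depth_nonneg i x)
    simp [preContraction, scaleFactor, lowered, apexWeight, this]
  have hpos : 0 < 1 + ∑ i, hs.depth i x :=
    add_pos_of_pos_of_nonneg one_pos (Finset.sum_nonneg fun i _ => hs.depth_nonneg i x)
  ext v
  simp only [contraction, h]
  rw [← Finset.mul_sum, hsum]
  field_simp

theorem contraction_notMem_openCell (hs : IsStarWithCells Δ o d s)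
    (hx : ∀ i, x ∉ openCell Δ (s i)) (t : unitInterval) (i : ι) :
    hs.contraction (t, x) ∉ openCell Δ (s i) := by
  intro h
  have hsub : s i ⊆ insert o (Finset.univ.filter fun v => (x : V → ℝ) v ≠ 0) := by
    intro v hv
    have h0 := (h v hv).ne'
    by_contra hvi
    simp only [Finset.mem_insert, not_or, Finset.mem_filter, Finset.mem_univ, true_and,
      not_not] at hvi
    simp [contraction, hs.preContraction_of_notMem hx, hvi] at h0
  have := hs.eq_of_subset (hs.insert_support_mem hx) hsub
  exact hs.notMem i (this ▸ Finset.mem_insert_self o _)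

theorem contraction_one (hs : IsStarWithCells Δ o d s)
    (hx : ∀ i, x ∉ openCell Δ (s i)) (v : V) :
    (hs.contraction (1, x) : V → ℝ) v = if v = o then 1 else 0 := by
  have hc := (cutoff_pos d).ne'
  simp only [contraction, hs.preContraction_of_notMem hx]
  by_cases h : v = o <;> simp [h, hc]

end IsStarWithCells

end Star

/-! ### Charts on open simplices, and the wedge of spheres -/

section Chart

variable {V : Type*} [Fintype V] [DecidableEq V] {d : ℕ} {σ : Finset V} (e : Fin (d + 1) ≃ σ)

/-- Coordinates on the open simplex `σ`: the logarithms of the ratios of barycentric coordinates. -/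
noncomputable def cellCoord (x : V → ℝ) : Fin d → ℝ :=
  fun k => Real.log (x (e k.succ)) - Real.log (x (e 0))

/-- The point of the open simplex `σ` with given logarithmic coordinates. -/
noncomputable def cellPoint (y : Fin d → ℝ) (v : V) : ℝ :=
  if h : v ∈ σ then
    Real.exp ((Fin.cons 0 y : Fin (d + 1) → ℝ) (e.symm ⟨v, h⟩)) /
      ∑ k, Real.exp ((Fin.cons 0 y : Fin (d + 1) → ℝ) k)
  else 0

omit [Fintype V] in
theorem cellPoint_apply (y : Fin d → ℝ) (k : Fin (d + 1)) :
    cellPoint e y (e k) = Real.exp ((Fin.cons 0 y : Fin (d + 1) → ℝ) k) /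
      ∑ k, Real.exp ((Fin.cons 0 y : Fin (d + 1) → ℝ) k) := by
  simp [cellPoint]

theorem sum_exp_pos (f : Fin (d + 1) → ℝ) : 0 < ∑ k, Real.exp (f k) :=
  Finset.sum_pos (fun _ _ => Real.exp_pos _) Finset.univ_nonempty

omit [DecidableEq V] in
theorem sum_eq_sum_cell {f : V → ℝ} (hf : ∀ v ∉ σ, f v = 0) :
    ∑ v, f v = ∑ k, f (e k) := by
  rw [← Finset.sum_subset (Finset.subset_univ σ) fun v _ hv => hf v hv, ← Finset.sum_coe_sort,
    ← Equiv.sum_comp e]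

omit [Fintype V] in
theorem cellPoint_pos (y : Fin d → ℝ) {v : V} (hv : v ∈ σ) : 0 < cellPoint e y v := by
  rw [cellPoint, dif_pos hv]
  exact div_pos (Real.exp_pos _) (sum_exp_pos _)

theorem cellPoint_mem_realization {Δ : Complex V} (hσ : σ ∈ Δ) (y : Fin d → ℝ) :
    cellPoint e y ∈ realization Δ := by
  have h0 : ∀ v ∉ σ, cellPoint e y v = 0 := fun v hv => by rw [cellPoint, dif_neg hv]
  refine ⟨⟨fun v => ?_, ?_⟩, σ, hσ, fun v hv => by_contra fun h => hv (h0 v h)⟩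
  · by_cases hv : v ∈ σ
    · exact (cellPoint_pos e y hv).le
    · exact (h0 v hv).ge
  · rw [sum_eq_sum_cell e h0]
    simp only [cellPoint_apply]
    rw [← Finset.sum_div, div_self (sum_exp_pos _).ne']

omit [Fintype V] in
theorem continuous_cellPoint : Continuous (cellPoint e) := by
  have h : ∀ k, Continuous fun y : Fin d → ℝ => (Fin.cons 0 y : Fin (d + 1) → ℝ) k := by
    intro k
    cases k using Fin.cases <;> simp only [Fin.cons_zero, Fin.cons_succ] <;> fun_prop
  refine continuous_pi fun v => ?_
  by_cases hv : v ∈ σ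
  · simp only [cellPoint, dif_pos hv]
    exact (Real.continuous_exp.comp (h _)).div
      (continuous_finsetSum _ fun k _ => Real.continuous_exp.comp (h k))
      fun y => (sum_exp_pos _).ne'
  · simp only [cellPoint, dif_neg hv]
    exact continuous_const

omit [Fintype V] in
theorem cellCoord_cellPoint (y : Fin d → ℝ) : cellCoord e (cellPoint e y) = y := by
  ext k
  rw [cellCoord, cellPoint_apply, cellPoint_apply,
    Real.log_div (Real.exp_ne_zero _) (sum_exp_pos _).ne',
    Real.log_div (Real.exp_ne_zero _) (sum_exp_pos _).ne']
  simp

theorem cellPoint_cellCoord {x : V → ℝ} (hx : x ∈ stdSimplex ℝ V) (hpos : ∀ v ∈ σ, 0 < x v)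
    (h0 : ∀ v, x v ≠ 0 → v ∈ σ) : cellPoint e (cellCoord e x) = x := by
  have hk : ∀ k, 0 < x (e k) := fun k => hpos _ (e k).2
  have hexp : ∀ k, Real.exp ((Fin.cons 0 (cellCoord e x) : Fin (d + 1) → ℝ) k) =
      x (e k) / x (e 0) := by
    intro k
    cases k using Fin.cases with
    | zero => simp [(hk 0).ne']
    | succ k => rw [Fin.cons_succ, cellCoord, Real.exp_sub, Real.exp_log (hk _),
        Real.exp_log (hk _)]
  have h0' : ∀ v ∉ σ, x v = 0 := fun v hv => by_contra fun h => hv (h0 v h)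
  have hsum : ∑ k, x (e k) = 1 := by
    rw [← sum_eq_sum_cell e h0']
    exact hx.2
  ext v
  by_cases hv : v ∈ σ
  · obtain ⟨k, hke⟩ := e.surjective ⟨v, hv⟩
    have hkv : (e k : V) = v := congrArg Subtype.val hke
    rw [← hkv, cellPoint_apply]
    simp only [hexp]
    rw [← Finset.sum_div, hsum]
    have := (hk 0).ne'
    field_simp
  · rw [cellPoint, dif_neg hv, h0' v hv]

omit [Fintype V] [DecidableEq V] in
theorem continuousOn_cellCoord : ContinuousOn (cellCoord e) {x | ∀ v ∈ σ, 0 < x v} := by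
  refine continuousOn_pi.2 fun k => ?_
  exact ((continuous_apply _).continuousOn.log fun x hx => (hx _ (e k.succ).2).ne').sub
    ((continuous_apply _).continuousOn.log fun x hx => (hx _ (e 0).2).ne')

end Chart

namespace IsStarWithCells

variable {V ι : Type*} [Fintype V] [DecidableEq V] [Fintype ι] {Δ : Complex V} {o : V} {d : ℕ}
  {s : ι → Finset V}

omit [Fintype ι] in
theorem continuous_collapse (hs : IsStarWithCells Δ o d s) (i : ι) (e : Fin (d + 1) ≃ s i) :
    Continuous (collapseMap (openCell Δ (s i)) fun x => cellCoord e x) := by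
  refine continuous_collapseMap (isOpen_openCell _) (g := fun y =>
    ⟨cellPoint e y, cellPoint_mem_realization e (hs.mem i) y⟩) ?_ ?_ ?_ ?_ ?_
  · exact (continuousOn_cellCoord e).comp continuous_subtype_val.continuousOn fun x hx => hx
  · exact (continuous_cellPoint e).subtype_mk _
  · exact fun y v hv => cellPoint_pos e y hv
  · exact fun x hx => Subtype.ext (cellPoint_cellCoord e x.2.1 hx fun v => hs.mem_of_openCell hx)
  · exact cellCoord_cellPoint e

/-- A star with `d`-simplices attached is homotopy equivalent to the quotient by the star, a wedge
of `d`-spheres. -/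
theorem homotopyEquiv_wedge (hs : IsStarWithCells Δ o d s) :
    Nonempty (ContinuousMap.HomotopyEquiv (realization Δ)
      (Wedge (fun _ : ι => UnitSphere d) fun _ => spherePoint d)) := by
  classical
  obtain ⟨S, hS⟩ := exists_onePoint_homeomorph_sphere d
  let e : ∀ i, Fin (d + 1) ≃ s i := fun i => ((s i).equivFinOfCardEq (hs.card i)).symm
  let F : realization Δ → ι → UnitSphere d := fun x i =>
    S (collapseMap (openCell Δ (s i)) (fun x => cellCoord (e i) x) x)
  let p : ι → UnitSphere d := fun _ => spherePoint d
  have hF : Continuous F := continuous_pi fun i =>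
    S.continuous.comp (hs.continuous_collapse i (e i))
  have hFmem : ∀ x i, x ∈ openCell Δ (s i) →
      F x i = S ((cellCoord (e i) x : Fin d → ℝ) : OnePoint (Fin d → ℝ)) := fun x i hx => by
    simp [F, collapseMap, hx]
  have hFnot : ∀ x i, x ∉ openCell Δ (s i) → F x i = p i := fun x i hx => by
    simp [F, collapseMap, hx, hS, p]
  have hne : ∀ y : Fin d → ℝ, S (y : OnePoint (Fin d → ℝ)) ≠ spherePoint d := fun y h =>
    OnePoint.coe_ne_infty y (S.injective (h.trans hS.symm))
  have hFupd : ∀ x i, x ∈ openCell Δ (s i) → F x = Function.update p i (F x i) := by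
    intro x i hx
    ext1 j
    by_cases hj : j = i
    · subst hj
      rw [Function.update_self]
    · rw [Function.update_of_ne hj, hFnot]
      exact fun h => hj (hs.eq_of_openCell h hx)
  have hFbase : ∀ x, (∀ i, x ∉ openCell Δ (s i)) → F x = p := fun x hx =>
    funext fun i => hFnot x i (hx i)
  have hvertex : (Pi.single o 1 : V → ℝ) ∈ realization Δ :=
    ⟨single_mem_stdSimplex ℝ o, {o}, hs.singleton_mem, fun v hv => by
      by_contra h
      exact hv (Pi.single_eq_of_ne (by simpa using h) 1)⟩
  have hvertex' : ∀ i, (⟨_, hvertex⟩ : realization Δ) ∉ openCell Δ (s i) := by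
    intro i h
    obtain ⟨v, hv⟩ := hs.nonempty i
    have hvo : v ≠ o := fun h => hs.notMem i (h ▸ hv)
    have := h v hv
    simp [hvo] at this
  have hrange : Set.range F = Set.range (wedgeToPi p) := by
    ext f
    constructor
    · rintro ⟨x, rfl⟩
      by_cases hx : ∃ i, x ∈ openCell Δ (s i)
      · obtain ⟨i, hx⟩ := hx
        refine ⟨Quot.mk _ (Sum.inr ⟨i, F x i⟩), ?_⟩
        rw [hFupd x i hx]
        simp only [wedgeToPi, Sum.elim_inr, Function.update_self]
      · exact ⟨Quot.mk _ (Sum.inl ()), (hFbase x (not_exists.1 hx)).symm⟩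
    · have hp : ∃ x, F x = p := ⟨_, hFbase _ hvertex'⟩
      rintro ⟨⟨⟨⟩ | ⟨i, y⟩⟩, rfl⟩
      · exact hp
      · obtain ⟨z, rfl⟩ := S.surjective y
        change ∃ x, F x = Function.update p i (S z)
        induction z using OnePoint.rec with
        | infty =>
          have : Function.update p i (S OnePoint.infty) = p := by
            rw [hS]
            exact Function.update_eq_self i p
          rw [this]
          exact hp
        | coe z =>
          have hz : (⟨_, cellPoint_mem_realization (e i) (hs.mem i) z⟩ : realization Δ) ∈
              openCell Δ (s i) := fun v hv => cellPoint_pos (e i) z hv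
          refine ⟨_, (hFupd _ i hz).trans ?_⟩
          rw [hFmem _ i hz]
          simp only [cellCoord_cellPoint]
  have hcompact : CompactSpace (realization Δ) := by
    rw [← isCompact_iff_compactSpace]
    have : realization Δ = ⋃ σ ∈ (Δ : Set (Finset V)), stdSimplex ℝ V ∩
        ⋂ v ∈ (σ : Set V)ᶜ, {x | x v = 0} := by
      ext x
      simp only [realization, Set.mem_ofPred_eq, Set.mem_iUnion, Set.mem_inter_iff, Set.mem_iInter,
        Set.mem_compl_iff, SetLike.mem_coe, exists_prop]
      constructor
      · rintro ⟨hx, σ, hσ, h⟩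
        exact ⟨σ, hσ, hx, fun v hv => by_contra fun h' => hv (h v h')⟩
      · rintro ⟨σ, hσ, hx, h⟩
        exact ⟨hx, σ, hσ, fun v hv => by_contra fun h' => hv (h v h')⟩
    rw [this]
    refine (Set.toFinite _).isCompact_biUnion fun σ _ => (isCompact_stdSimplex ℝ V).inter_right ?_
    exact isClosed_biInter fun v _ => isClosed_eq (continuous_apply v) continuous_const
  have main : Nonempty (ContinuousMap.HomotopyEquiv (realization Δ) (Set.range F)) := by
    refine homotopyEquiv_range_of_contraction hF (A := {x | ∀ i, x ∉ openCell Δ (s i)}) ?_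
      hs.contraction hs.continuous_contraction hs.contraction_zero
      (fun t a ha => hs.contraction_notMem_openCell ha t) ⟨_, hvertex⟩ fun a ha => ?_
    · intro x y
      constructor
      · intro hxy
        have key : ∀ i, x ∈ openCell Δ (s i) ↔ y ∈ openCell Δ (s i) := by
          intro i
          have hi := congrFun hxy i
          constructor
          · intro hx
            by_contra hy
            rw [hFmem x i hx, hFnot y i hy] at hi
            exact hne _ hi
          · intro hy
            by_contra hx
            rw [hFmem y i hy, hFnot x i hx] at hi
            exact hne _ hi.symm
        by_cases hx : ∃ i, x ∈ openCell Δ (s i)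
        · obtain ⟨i, hx⟩ := hx
          have hy := (key i).1 hx
          have hi := congrFun hxy i
          rw [hFmem x i hx, hFmem y i hy] at hi
          have hc := OnePoint.coe_injective (S.injective hi)
          left
          rw [Subtype.ext_iff,
            ← cellPoint_cellCoord (e i) x.2.1 hx fun v => hs.mem_of_openCell hx,
            ← cellPoint_cellCoord (e i) y.2.1 hy fun v => hs.mem_of_openCell hy, hc]
        · have hx := not_exists.1 hx
          exact .inr ⟨hx, fun i hy => hx i ((key i).2 hy)⟩
      · rintro (rfl | ⟨hx, hy⟩)
        · rfl
        · rw [hFbase x hx, hFbase y hy]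
    · ext v
      rw [hs.contraction_one ha]
      simp [Pi.single_apply]
  obtain ⟨E⟩ := main
  exact ⟨E.trans ((Homeomorph.setCongr hrange).trans
    (isEmbedding_wedgeToPi p).toHomeomorph.symm).toHomotopyEquiv⟩

end IsStarWithCells

/-! ### Sequences of element matchings -/

section Matching

variable {X : Type*} [DecidableEq X]

theorem isMatched_elementMatching_iff {S : Set (Finset X)} {x : X} {σ : Finset X} :
    IsMatched (elementMatching S x) σ ↔ σ.erase x ∈ S ∧ insert x σ ∈ S := by
  constructor
  · rintro ⟨_, ⟨τ, h₁, h₂, rfl⟩, hσ⟩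
    rcases Sym2.mem_iff.1 hσ with rfl | rfl
    · exact ⟨by simpa using h₁, by rwa [show insert x (τ.erase x) = insert x τ by grind]⟩
    · exact ⟨by rwa [Finset.erase_insert_eq_erase], by simpa using h₂⟩
  · rintro ⟨h₁, h₂⟩
    refine ⟨_, ⟨σ, h₁, h₂, rfl⟩, Sym2.mem_iff.2 ?_⟩
    by_cases h : x ∈ σ
    · exact .inr (Finset.insert_eq_of_mem h).symm
    · exact .inl (Finset.erase_eq_of_notMem h).symm

theorem mem_remaining_iff {n : ℕ} {S : Set (Finset X)} {x : Fin n → X} {k : ℕ} {σ : Finset X} :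
    σ ∈ remaining S x k ↔ σ ∈ S ∧ ∀ i : Fin n, (i : ℕ) < k →
      ¬ IsMatched (elementMatching (remaining S x i) (x i)) σ := by
  induction k with
  | zero => simp [remaining]
  | succ k ih =>
    simp only [remaining, Set.mem_ofPred_eq, ih, and_assoc]
    refine and_congr_right fun _ => ⟨fun h i hi => ?_, fun h => ⟨fun i hi => h i (by omega),
      fun hk => h ⟨k, hk⟩ (Nat.lt_succ_self k)⟩⟩
    rcases Nat.lt_succ_iff_lt_or_eq.1 hi with hi | hi
    · exact h.1 i hi
    · subst hi
      exact h.2 i.2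

theorem critical_sequenceMatching {n : ℕ} (S : Set (Finset X)) (x : Fin n → X) :
    critical S (sequenceMatching S x) = remaining S x n := by
  ext σ
  rw [mem_remaining_iff]
  simp only [critical, sequenceMatching, IsMatched, Set.mem_ofPred_eq, Set.mem_iUnion]
  refine and_congr_right fun _ => ⟨?_, ?_⟩
  · rintro h i - ⟨e, he, hσ⟩
    exact h ⟨e, ⟨i, he⟩, hσ⟩
  · rintro h ⟨e, ⟨i, he⟩, hσ⟩
    exact h i i.2 ⟨e, he, hσ⟩

end Matching

/-! ### Faces of the total 2-cut complex -/

theorem mem_totalCutComplex_two {V : Type*} [Fintype V] [DecidableEq V] {G : SimpleGraph V}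
    {σ : Finset V} : σ ∈ totalCutComplex 2 G ↔ ¬ G.IsClique (↑(σᶜ) : Set V) := by
  simp only [totalCutComplex, mem_lowerClosure, Set.mem_ofPred_eq]
  constructor
  · rintro ⟨τ, ⟨hτ, hind⟩, hle⟩ hcl
    have h2 : τᶜ.card = 2 := by rw [Finset.card_compl]; omega
    obtain ⟨a, b, hab, hτab⟩ := Finset.card_eq_two.1 h2
    have ha : a ∈ τᶜ := by simp [hτab]
    have hb : b ∈ τᶜ := by simp [hτab]
    have hle' : τᶜ ⊆ σᶜ := Finset.compl_subset_compl.2 hle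
    exact hind ha hb hab (hcl (hle' ha) (hle' hb) hab)
  · intro h
    simp only [SimpleGraph.IsClique, Set.Pairwise, not_forall] at h
    obtain ⟨a, ha, b, hb, hab, hadj⟩ := h
    refine ⟨{a, b}ᶜ, ⟨?_, ?_⟩, ?_⟩
    · rw [Finset.card_compl, Finset.card_pair hab]
      have := Finset.card_le_univ ({a, b} : Finset V)
      rw [Finset.card_pair hab] at this
      omega
    · rw [compl_compl]
      intro u hu v hv huv
      simp only [Finset.coe_insert, Finset.coe_singleton, Set.mem_insert_iff,
        Set.mem_singleton_iff] at hu hv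
      rcases hu with rfl | rfl <;> rcases hv with rfl | rfl
      · exact absurd rfl huv
      · exact hadj
      · exact fun h => hadj h.symm
      · exact absurd rfl huv
    · rw [← Finset.compl_subset_compl, compl_compl]
      intro u hu
      simp only [Finset.mem_insert, Finset.mem_singleton] at hu
      rcases hu with rfl | rfl
      · exact ha
      · exact hb

theorem completeBoxPath_adj {m n : ℕ} {a b : Fin m × Fin n} :
    (completeBoxPath m n).Adj a b ↔ (a.2 = b.2 ∧ a.1 ≠ b.1) ∨
      (a.1 = b.1 ∧ ((a.2 : ℕ) + 1 = b.2 ∨ (b.2 : ℕ) + 1 = a.2)) := by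
  simp only [completeBoxPath, SimpleGraph.boxProd_adj, SimpleGraph.top_adj,
    SimpleGraph.pathGraph_adj]
  tauto

/-! ### The element matchings on `K_m □ P_n` -/

section Box

variable {m n : ℕ}

/-- The cliques `K` of `K_m □ P_n` such that the complement of `K ∪ {(z, 0)}` is left unmatched by
the element matchings using `(z, 0), …, (z, k)`: the clique has a vertex in a column beyond `k`
other than `(z, k + 1)`, or it contains two vertices of a row other than row `z`. -/
def Survives (z : Fin m) (k : ℕ) (K : Finset (Fin m × Fin n)) : Prop :=
  (completeBoxPath m n).IsClique (K : Set (Fin m × Fin n)) ∧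
    ((∃ a ∈ K, k < (a.2 : ℕ) ∧ (a.1 = z → (a.2 : ℕ) ≠ k + 1)) ∨
      ∃ a ∈ K, ∃ b ∈ K, a.1 ≠ z ∧ a.1 = b.1 ∧ (a.2 : ℕ) + 1 = b.2)

theorem isClique_iff {K : Finset (Fin m × Fin n)} :
    (completeBoxPath m n).IsClique (K : Set (Fin m × Fin n)) ↔
      ∀ a ∈ K, ∀ b ∈ K, a.2 = b.2 ∨
        (a.1 = b.1 ∧ ((a.2 : ℕ) + 1 = b.2 ∨ (b.2 : ℕ) + 1 = a.2)) := by
  simp only [SimpleGraph.IsClique, Set.Pairwise, Finset.mem_coe, completeBoxPath_adj]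
  refine forall₂_congr fun a _ => forall₂_congr fun b _ => ?_
  constructor
  · intro h
    by_cases hab : a = b
    · exact .inl (hab ▸ rfl)
    · have := h hab
      tauto
  · intro h hab
    rcases h with h | h
    · exact .inl ⟨h, fun h' => hab (Prod.ext h' h)⟩
    · exact .inr h

theorem Survives.mono {z : Fin m} {k : ℕ} {K L : Finset (Fin m × Fin n)} (h : Survives z k K)
    (hKL : K ⊆ L) (hL : (completeBoxPath m n).IsClique (L : Set (Fin m × Fin n))) :
    Survives z k L := by
  refine ⟨hL, ?_⟩
  rcases h.2 with ⟨a, ha, h⟩ | ⟨a, ha, b, hb, h⟩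
  · exact .inl ⟨a, hKL ha, h⟩
  · exact .inr ⟨a, hKL ha, b, hKL hb, h⟩

/-- A clique with two vertices of the same row consists of these two vertices. -/
theorem eq_pair_of_isClique {K : Finset (Fin m × Fin n)}
    (hK : (completeBoxPath m n).IsClique (K : Set (Fin m × Fin n))) {a b : Fin m × Fin n}
    (ha : a ∈ K) (hb : b ∈ K) (h₁ : a.1 = b.1) (h₂ : (a.2 : ℕ) + 1 = b.2) : K = {a, b} := by
  rw [isClique_iff] at hK
  refine Finset.Subset.antisymm (fun c hc => ?_) (by simp [Finset.insert_subset_iff, ha, hb])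
  have hca := hK c hc a ha
  have hcb := hK c hc b hb
  obtain ⟨c₁, c₂⟩ := c
  obtain ⟨a₁, a₂⟩ := a
  obtain ⟨b₁, b₂⟩ := b
  simp only [Fin.ext_iff] at *
  simp only [Finset.mem_insert, Finset.mem_singleton, Prod.mk.injEq, Fin.ext_iff]
  omega

/-- One step of the sequence of matchings, read on complements. -/
theorem survives_succ_iff {z : Fin m} {k : ℕ} (hk : k + 1 < n) {K : Finset (Fin m × Fin n)} :
    Survives z (k + 1) K ↔ Survives z k K ∧
      ¬ (Survives z k (insert (z, ⟨k + 1, hk⟩) K) ∧ Survives z k (K.erase (z, ⟨k + 1, hk⟩))) := by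
  constructor
  · intro h
    refine ⟨⟨h.1, ?_⟩, fun ⟨hI, _⟩ => ?_⟩
    · rcases h.2 with ⟨a, ha, h, -⟩ | h
      · exact .inl ⟨a, ha, by omega, by omega⟩
      · exact .inr h
    · have hy := isClique_iff.1 hI.1 _ (Finset.mem_insert_self _ _)
      rcases h.2 with ⟨a, ha, h, h'⟩ | ⟨a, ha, b, hb, h, h', h''⟩
      · have := hy a (Finset.mem_insert_of_mem ha)
        simp only [Fin.ext_iff] at *
        omega
      · have h₁ := hy a (Finset.mem_insert_of_mem ha)
        have h₂ := hy b (Finset.mem_insert_of_mem hb)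
        simp only [Fin.ext_iff] at *
        omega
  · rintro ⟨⟨hK, h⟩, hno⟩
    refine ⟨hK, ?_⟩
    rcases h with ⟨a, ha, h, h'⟩ | h
    swap
    · exact .inr h
    -- Otherwise `K` lies in the column of `(z, k + 1)`, or contains at most `(z, k + 1)` and
    -- `(z, k + 2)`, and is matched by toggling `(z, k + 1)`.
    by_contra hcon
    rw [not_or] at hcon
    obtain ⟨hcol, hrow⟩ := hcon
    have hcol' : ∀ c ∈ K, k + 1 < (c.2 : ℕ) → c.1 = z ∧ (c.2 : ℕ) = k + 2 := by
      intro c hc hlt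
      by_contra hc'
      exact hcol ⟨c, hc, hlt, by omega⟩
    have hrow' : ∀ c ∈ K, ∀ d ∈ K, c.1 = d.1 → (c.2 : ℕ) + 1 = d.2 → c.1 = z := by
      intro c hc d hd h₁ h₂
      by_contra hc'
      exact hrow ⟨c, hc, d, hd, hc', h₁, h₂⟩
    have hyc : ∀ c ∈ K, (c.2 : ℕ) = k + 1 ∨ (c.1 = z ∧ (c.2 : ℕ) = k + 2) ∨
        (c.1 = z ∧ (c.2 : ℕ) = k) := by
      intro c hc
      have h₁ := isClique_iff.1 hK c hc a ha
      have h₂ := hcol' a ha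
      have h₃ := hcol' c hc
      have h₄ := hrow' a ha c hc
      have h₅ := hrow' c hc a ha
      simp only [Fin.ext_iff] at *
      omega
    have hI : (completeBoxPath m n).IsClique
        ((insert (z, ⟨k + 1, hk⟩) K : Finset (Fin m × Fin n)) : Set (Fin m × Fin n)) := by
      rw [isClique_iff]
      intro c hc d hd
      rw [Finset.mem_insert] at hc hd
      rcases hc with rfl | hc <;> rcases hd with rfl | hd
      · exact .inl rfl
      · have := hyc d hd
        simp only [Fin.ext_iff] at *
        omega
      · have := hyc c hc
        simp only [Fin.ext_iff] at *
        omega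
      · exact isClique_iff.1 hK c hc d hd
    refine hno ⟨Survives.mono ⟨hK, .inl ⟨a, ha, h, h'⟩⟩ (Finset.subset_insert _ _) hI,
      hK.subset (by simp), .inl ⟨a, Finset.mem_erase.2 ⟨?_, ha⟩, h, h'⟩⟩
    rintro rfl
    exact h' rfl rfl

theorem mem_remaining_succ {z : Fin m} {k : ℕ} (hk : k < n) {σ : Finset (Fin m × Fin n)} :
    σ ∈ remaining (totalCutComplex 2 (completeBoxPath m n) : Set (Finset (Fin m × Fin n)))
        (fun j : Fin n => (z, j)) (k + 1) ↔
      (z, ⟨0, by omega⟩) ∉ σ ∧ Survives z k (σᶜ.erase (z, ⟨0, by omega⟩)) := by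
  induction k generalizing σ with
  | zero =>
    simp only [remaining, Set.mem_ofPred_eq, isMatched_elementMatching_iff, SetLike.mem_coe,
      mem_totalCutComplex_two, forall_prop_of_true hk]
    set o : Fin m × Fin n := (z, ⟨0, by omega⟩) with ho
    have h₁ : (σ.erase o)ᶜ = insert o σᶜ := by ext; simp [or_iff_not_imp_left]
    have h₂ : (insert o σ)ᶜ = σᶜ.erase o := by ext; simp
    rw [h₁, h₂]
    by_cases hoσ : o ∈ σ
    · have : σᶜ.erase o = σᶜ := Finset.erase_eq_of_notMem (by simpa using hoσ)
      rw [this]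
      have hmono : (completeBoxPath m n).IsClique (↑(insert o σᶜ) : Set (Fin m × Fin n)) →
          (completeBoxPath m n).IsClique (↑σᶜ : Set (Fin m × Fin n)) :=
        fun h => h.subset (by simp)
      tauto
    · have hoσ' : o ∈ σᶜ := by simpa using hoσ
      have hmem : ∀ a ∈ σᶜ, a = o ∨ a ∈ σᶜ.erase o := fun a ha => by
        by_cases h : a = o
        · exact .inl h
        · exact .inr (Finset.mem_erase.2 ⟨h, ha⟩)
      rw [Finset.insert_eq_of_mem hoσ']
      constructor
      · rintro ⟨h, h'⟩
        have hK : (completeBoxPath m n).IsClique (↑(σᶜ.erase o) : Set (Fin m × Fin n)) :=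
          not_not.1 fun hn => h' ⟨h, hn⟩
        refine ⟨hoσ, hK, .inl ?_⟩
        by_contra hno
        have hoa : ∀ a ∈ σᶜ.erase o, (a.2 : ℕ) = 0 ∨ (a.1 = z ∧ (a.2 : ℕ) = 1) := by
          intro a ha
          by_contra hc
          exact hno ⟨a, ha, by omega, by omega⟩
        refine h (isClique_iff.2 fun c hc d hd => ?_)
        rcases hmem c hc with rfl | hc <;> rcases hmem d hd with rfl | hd
        · exact .inl rfl
        · have := hoa d hd
          simp only [ho, Fin.ext_iff] at *
          omega
        · have := hoa c hc
          simp only [ho, Fin.ext_iff] at *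
          omega
        · exact isClique_iff.1 hK c hc d hd
      · rintro ⟨-, hK, h⟩
        refine ⟨fun hcl => ?_, fun hn => hn.2 hK⟩
        have hoa := isClique_iff.1 hcl o hoσ'
        rcases h with ⟨a, ha, h, h'⟩ | ⟨a, ha, b, hb, h, h', h''⟩
        · have := hoa a (Finset.mem_of_mem_erase ha)
          simp only [ho, Fin.ext_iff] at *
          omega
        · have := hoa b (Finset.mem_of_mem_erase hb)
          simp only [ho, Fin.ext_iff] at *
          omega
  | succ k ih =>
    have ih' := fun σ => ih (by omega) (σ := σ)
    rw [show remaining (totalCutComplex 2 (completeBoxPath m n) : Set (Finset (Fin m × Fin n)))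
        (fun j : Fin n => (z, j)) (k + 1 + 1) = {σ | _ ∧ _} from rfl]
    rw [Set.mem_ofPred_eq, survives_succ_iff hk]
    simp only [isMatched_elementMatching_iff, ih', forall_prop_of_true hk]
    set o : Fin m × Fin n := (z, ⟨0, by omega⟩) with ho
    set y : Fin m × Fin n := (z, ⟨k + 1, hk⟩) with hy
    have hoy : o ≠ y := by simp [ho, hy]
    have h₁ : (σ.erase y)ᶜ.erase o = insert y (σᶜ.erase o) := by
      ext v
      simp only [Finset.mem_erase, Finset.mem_compl, Finset.mem_insert]
      by_cases hv : v = y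
      · simp [hv, hoy.symm]
      · simp [hv]
    have h₂ : (insert y σ)ᶜ.erase o = (σᶜ.erase o).erase y := by
      ext v
      simp only [Finset.mem_erase, Finset.mem_compl, Finset.mem_insert]
      tauto
    have h₃ : o ∉ insert y σ ↔ o ∉ σ := by simp [hoy]
    have h₄ : o ∉ σ.erase y ↔ o ∉ σ := by simp [hoy]
    rw [h₁, h₂, h₃, h₄]
    tauto

/-- The cliques that survive all matchings are the pairs of consecutive vertices of a row other
than row `z`. -/
theorem survives_last_iff {z : Fin m} {k : ℕ} (hk : k + 1 = n) {K : Finset (Fin m × Fin n)} :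
    Survives z k K ↔ ∃ a b : Fin m × Fin n, a.1 ≠ z ∧ a.1 = b.1 ∧ (a.2 : ℕ) + 1 = b.2 ∧
      K = {a, b} := by
  constructor
  · rintro ⟨hK, ⟨a, ha, h, -⟩ | ⟨a, ha, b, hb, h, h', h''⟩⟩
    · have := a.2.2
      omega
    · exact ⟨a, b, h, h', h'', eq_pair_of_isClique hK ha hb h' h''⟩
  · rintro ⟨a, b, h, h', h'', rfl⟩
    refine ⟨?_, .inr ⟨a, by simp, b, by simp, h, h', h''⟩⟩
    rw [isClique_iff]
    intro c hc d hd
    simp only [Finset.mem_insert, Finset.mem_singleton] at hc hd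
    rcases hc with rfl | rfl <;> rcases hd with rfl | rfl <;> simp [*]

/-- The unmatched faces and the star of `(z, 0)` form a subcomplex, since a clique larger than a
surviving clique survives. -/
theorem mem_remaining_of_subset {z : Fin m} {k : ℕ} (hk : k < n) {σ ρ : Finset (Fin m × Fin n)}
    (hσ : σ ∈ remaining (totalCutComplex 2 (completeBoxPath m n) : Set (Finset (Fin m × Fin n)))
      (fun j : Fin n => (z, j)) (k + 1)) (hρ : ρ ⊆ σ)
    (hstar : insert (z, ⟨0, by omega⟩) ρ ∉ totalCutComplex 2 (completeBoxPath m n)) :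
    ρ ∈ remaining (totalCutComplex 2 (completeBoxPath m n) : Set (Finset (Fin m × Fin n)))
      (fun j : Fin n => (z, j)) (k + 1) := by
  rw [mem_remaining_succ hk] at hσ ⊢
  rw [mem_totalCutComplex_two, not_not, Finset.compl_insert] at hstar
  exact ⟨fun h => hσ.1 (hρ h),
    hσ.2.mono (Finset.erase_subset_erase _ (Finset.compl_subset_compl.2 hρ)) hstar⟩

end Box

/-! ### The homotopy type of the total 2-cut complex of `K_m □ P_n` -/

section Box

variable {m n : ℕ}

/-- The subcomplex of the faces of the total 2-cut complex that are in the star of `(z, 0)` or are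
left unmatched by the element matchings using `(z, 0), …, (z, k)`. -/
def unmatchedComplex (z : Fin m) (k : ℕ) (hk : k < n) : Complex (Fin m × Fin n) where
  carrier := {σ | σ ∈ totalCutComplex 2 (completeBoxPath m n) ∧
    (insert (z, ⟨0, by omega⟩) σ ∈ totalCutComplex 2 (completeBoxPath m n) ∨
      σ ∈ remaining (totalCutComplex 2 (completeBoxPath m n) : Set (Finset (Fin m × Fin n)))
        (fun j : Fin n => (z, j)) (k + 1))}
  lower' := by
    rintro σ ρ hρ ⟨hσ, h⟩
    refine ⟨LowerSet.lower _ hρ hσ, or_iff_not_imp_left.2 fun hstar => ?_⟩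
    rcases h with h | h
    · exact absurd (LowerSet.lower _ (Finset.insert_subset_insert _ hρ) h) hstar
    · exact mem_remaining_of_subset hk h hρ hstar

theorem mem_unmatchedComplex {z : Fin m} {k : ℕ} {hk : k < n} {σ : Finset (Fin m × Fin n)} :
    σ ∈ unmatchedComplex z k hk ↔ σ ∈ totalCutComplex 2 (completeBoxPath m n) ∧
      (insert (z, ⟨0, by omega⟩) σ ∈ totalCutComplex 2 (completeBoxPath m n) ∨
        σ ∈ remaining (totalCutComplex 2 (completeBoxPath m n) : Set (Finset (Fin m × Fin n)))
          (fun j : Fin n => (z, j)) (k + 1)) :=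
  Iff.rfl

theorem pos_of_two_le {k : ℕ} (hk : 2 ≤ k) : 0 < k := by
  omega

theorem sub_one_lt {n : ℕ} (j : Fin n) : (j : ℕ) - 1 < n := by
  omega

theorem singleton_mem_totalCutComplex (hm : 2 ≤ m) (hn : 2 ≤ n) (z : Fin m) :
    {(z, ⟨0, pos_of_two_le hn⟩)} ∈ totalCutComplex 2 (completeBoxPath m n) := by
  have : Nontrivial (Fin m) := Fin.nontrivial_iff_two_le.2 hm
  obtain ⟨w, hw⟩ := exists_ne z
  rw [mem_totalCutComplex_two, isClique_iff]
  intro h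
  have := h (z, ⟨1, by omega⟩) (by simp) (w, ⟨0, pos_of_two_le hn⟩) (by simp [hw])
  simp [hw.symm] at this

theorem insert_notMem_of_mem_remaining {z : Fin m} {k : ℕ} (hk : k < n)
    {σ : Finset (Fin m × Fin n)}
    (hσ : σ ∈ remaining (totalCutComplex 2 (completeBoxPath m n) : Set (Finset (Fin m × Fin n)))
      (fun j : Fin n => (z, j)) (k + 1)) :
    insert (z, ⟨0, by omega⟩) σ ∉ totalCutComplex 2 (completeBoxPath m n) := by
  rw [mem_totalCutComplex_two, not_not, Finset.compl_insert]
  exact ((mem_remaining_succ hk).1 hσ).2.1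

theorem homotopyEquiv_unmatchedComplex (hm : 2 ≤ m) (hn : 2 ≤ n) (z : Fin m) (k : ℕ)
    (hk : k < n) : Nonempty (ContinuousMap.HomotopyEquiv
      (realization (totalCutComplex 2 (completeBoxPath m n)))
      (realization (unmatchedComplex z k hk))) := by
  induction k with
  | zero =>
    have : unmatchedComplex z 0 hk = totalCutComplex 2 (completeBoxPath m n) := by
      ext σ
      refine ⟨fun h => h.1, fun h => ⟨h, or_iff_not_imp_left.2 fun hstar => ⟨h, fun _ hM => ?_⟩⟩⟩
      exact hstar (isMatched_elementMatching_iff.1 hM).2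
    rw [this]
    exact ⟨ContinuousMap.HomotopyEquiv.refl _⟩
  | succ k ih =>
    obtain ⟨E⟩ := ih (by omega)
    have hsub : ∀ {σ}, σ ∈ remaining
        (totalCutComplex 2 (completeBoxPath m n) : Set (Finset (Fin m × Fin n)))
        (fun j : Fin n => (z, j)) (k + 1) → σ ∈ totalCutComplex 2 (completeBoxPath m n) :=
      fun h => (mem_remaining_iff.1 h).1
    have step : Nonempty (ContinuousMap.HomotopyEquiv
        (realization (unmatchedComplex z k (by omega : k < n)))
        (realization (unmatchedComplex z (k + 1) hk))) := by
      refine homotopyEquiv_of_toggle (fun σ hσ => ⟨hσ.1, hσ.2.imp_right fun h => h.1⟩) ?_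
        (z, ⟨k + 1, hk⟩) ?_
      · have h := singleton_mem_totalCutComplex hm hn z
        exact ⟨LowerSet.lower _ (Finset.empty_subset _) h, .inl h⟩
      · intro σ hσ hσ'
        rw [mem_unmatchedComplex] at hσ hσ'
        have hstar := fun h => hσ' ⟨hσ.1, .inl h⟩
        have hR := hσ.2.resolve_left hstar
        have hM : IsMatched (elementMatching (remaining
            (totalCutComplex 2 (completeBoxPath m n) : Set (Finset (Fin m × Fin n)))
            (fun j : Fin n => (z, j)) (k + 1)) (z, ⟨k + 1, hk⟩)) σ := by
          by_contra hM
          exact hσ' ⟨hσ.1, .inr ⟨hR, fun _ => hM⟩⟩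
        rw [isMatched_elementMatching_iff] at hM
        refine ⟨⟨hsub hM.2, .inr hM.2⟩, fun h => ?_⟩
        rcases h.2 with h | h
        · exact insert_notMem_of_mem_remaining (by omega) hM.1 h
        · refine h.2 hk (isMatched_elementMatching_iff.2 ⟨?_, ?_⟩)
          · rw [Finset.erase_idem]
            exact hM.1
          · rw [show insert ((z, ⟨k + 1, hk⟩) : Fin m × Fin n) (σ.erase (z, ⟨k + 1, hk⟩)) =
              insert (z, ⟨k + 1, hk⟩) σ by ext; simp; tauto]
            exact hM.2
    obtain ⟨E'⟩ := step
    exact ⟨E.trans E'⟩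

theorem mem_remaining_last (hm : 0 < m) (hn : 0 < n) {σ : Finset (Fin m × Fin n)} :
    σ ∈ remaining (totalCutComplex 2 (completeBoxPath m n) : Set (Finset (Fin m × Fin n)))
        (fun j : Fin n => ((⟨0, hm⟩ : Fin m), j)) n ↔
      ∃ (i : Fin m) (j : Fin n), 1 ≤ (i : ℕ) ∧ 1 ≤ (j : ℕ) ∧
        σᶜ = {(⟨0, hm⟩, ⟨0, hn⟩), (i, ⟨(j : ℕ) - 1, sub_one_lt j⟩), (i, j)} := by
  obtain ⟨k, rfl⟩ : ∃ k, n = k + 1 := ⟨n - 1, by omega⟩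
  rw [mem_remaining_succ (Nat.lt_succ_self k), survives_last_iff rfl]
  constructor
  · rintro ⟨ho, ⟨a₁, a₂⟩, ⟨b₁, b₂⟩, h, h', h'', hab⟩
    simp only [ne_eq, Fin.ext_iff] at h h' h''
    obtain rfl : a₁ = b₁ := Fin.ext h'
    refine ⟨a₁, b₂, by omega, by omega, ?_⟩
    rw [← Finset.insert_erase (Finset.mem_compl.2 ho), hab]
    congr 4
    exact Fin.ext (by simp; omega)
  · rintro ⟨i, j, hi, hj, h⟩
    refine ⟨by rw [← Finset.mem_compl, h]; simp, (i, ⟨(j : ℕ) - 1, sub_one_lt j⟩), (i, j), ?_, rfl, ?_,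
      ?_⟩
    · simp only [ne_eq, Fin.ext_iff]
      omega
    · simp only
      omega
    · rw [h, Finset.erase_insert]
      simp only [Finset.mem_insert, Finset.mem_singleton, Prod.mk.injEq, Fin.ext_iff]
      omega

/-- The critical faces, indexed by the `(m - 1) (n - 1)` pairs of consecutive vertices in the
rows other than row `0`. -/
def criticalFace (hm : 2 ≤ m) (hn : 2 ≤ n) (q : Fin (m - 1) × Fin (n - 1)) :
    Finset (Fin m × Fin n) :=
  {(⟨0, pos_of_two_le hm⟩, ⟨0, pos_of_two_le hn⟩),
    (⟨q.1 + 1, by omega⟩, ⟨q.2, by omega⟩),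
    (⟨q.1 + 1, by omega⟩, ⟨q.2 + 1, by omega⟩)}ᶜ

theorem criticalFace_injective (hm : 2 ≤ m) (hn : 2 ≤ n) :
    Function.Injective (criticalFace hm hn) := by
  intro p q h
  have h := compl_injective h
  have h₁ := (Finset.ext_iff.1 h (⟨p.1 + 1, by omega⟩, ⟨p.2, by omega⟩)).1 (by simp)
  have h₂ := (Finset.ext_iff.1 h (⟨p.1 + 1, by omega⟩, ⟨p.2 + 1, by omega⟩)).1 (by simp)
  simp only [Finset.mem_insert, Finset.mem_singleton, Prod.mk.injEq, Fin.ext_iff] at h₁ h₂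
  refine Prod.ext (Fin.ext ?_) (Fin.ext ?_) <;> omega

theorem mem_remaining_iff_criticalFace (hm : 2 ≤ m) (hn : 2 ≤ n) {σ : Finset (Fin m × Fin n)} :
    σ ∈ remaining (totalCutComplex 2 (completeBoxPath m n) : Set (Finset (Fin m × Fin n)))
        (fun j : Fin n => ((⟨0, pos_of_two_le hm⟩ : Fin m), j)) n ↔ ∃ q, σ = criticalFace hm hn q := by
  rw [mem_remaining_last (pos_of_two_le hm) (pos_of_two_le hn)]
  constructor
  · rintro ⟨i, j, hi, hj, h⟩
    refine ⟨(⟨i - 1, by omega⟩, ⟨j - 1, by omega⟩), compl_injective ?_⟩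
    rw [h, criticalFace, compl_compl]
    congr 4 <;> simp only [Fin.ext_iff] <;> omega
  · rintro ⟨q, rfl⟩
    exact ⟨⟨q.1 + 1, by omega⟩, ⟨q.2 + 1, by omega⟩, by simp, by simp, by
      rw [criticalFace, compl_compl]
      rfl⟩

theorem card_criticalFace (hm : 2 ≤ m) (hn : 2 ≤ n) (q : Fin (m - 1) × Fin (n - 1)) :
    (criticalFace hm hn q).card = m * n - 4 + 1 := by
  have h4 : 2 * 2 ≤ m * n := Nat.mul_le_mul hm hn
  rw [criticalFace, Finset.card_compl, Finset.card_eq_three.2 ⟨_, _, _, ?_, ?_, ?_, rfl⟩]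
  · simp only [Fintype.card_prod, Fintype.card_fin]
    omega
  all_goals
    simp [Fin.ext_iff]

theorem isStarWithCells_unmatchedComplex (hm : 2 ≤ m) (hn : 2 ≤ n) :
    IsStarWithCells (unmatchedComplex (⟨0, pos_of_two_le hm⟩ : Fin m) (n - 1) (by omega : n - 1 < n))
      (⟨0, pos_of_two_le hm⟩, ⟨0, pos_of_two_le hn⟩) (m * n - 4)
      (fun r : Fin ((m - 1) * (n - 1)) => criticalFace hm hn (finProdFinEquiv.symm r)) := by
  have hk : n - 1 < n := by omega
  have hlast : ∀ σ, σ ∈ remaining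
      (totalCutComplex 2 (completeBoxPath m n) : Set (Finset (Fin m × Fin n)))
      (fun j : Fin n => ((⟨0, pos_of_two_le hm⟩ : Fin m), j)) (n - 1 + 1) ↔
      ∃ r, σ = criticalFace hm hn (finProdFinEquiv.symm r) := by
    intro σ
    rw [Nat.sub_add_cancel (by omega), mem_remaining_iff_criticalFace hm hn,
      finProdFinEquiv.symm.surjective.exists]
  have hcrit := fun r => (hlast _).2 ⟨r, rfl⟩
  have ho := singleton_mem_totalCutComplex hm hn (⟨0, pos_of_two_le hm⟩ : Fin m)
  exact
    { singleton_mem := ⟨ho, .inl (by rwa [Finset.insert_eq_of_mem (by simp)])⟩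
      injective := (criticalFace_injective hm hn).comp finProdFinEquiv.symm.injective
      mem := fun r => ⟨(mem_remaining_iff.1 (hcrit r)).1, .inr (hcrit r)⟩
      insert_notMem := fun r h => insert_notMem_of_mem_remaining hk (hcrit r) h.1
      card := fun r => card_criticalFace hm hn _
      insert_mem_or := fun ρ hρ => hρ.2.imp
        (fun h => ⟨h, .inl (by rwa [Finset.insert_eq_of_mem (by simp)])⟩) (hlast ρ).1 }

end Box

end TotalCut

open TotalCut in
theorem theorem3p9 (m n : ℕ) (hm : 2 ≤ m) (hn : 2 ≤ n) :
    Nonempty (ContinuousMap.HomotopyEquiv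
      (realization (totalCutComplex 2 (completeBoxPath m n)))
      (WedgeOfSpheres ((m - 1) * (n - 1)) (m * n - 4))) ∧
    ∀ σ : Finset (Fin m × Fin n),
      σ ∈ critical (totalCutComplex 2 (completeBoxPath m n) : Set (Finset (Fin m × Fin n)))
          (sequenceMatching (totalCutComplex 2 (completeBoxPath m n) : Set (Finset (Fin m × Fin n)))
            (fun j : Fin n => ((⟨0, by omega⟩ : Fin m), j))) ↔
        ∃ (i : Fin m) (j : Fin n), 1 ≤ (i : ℕ) ∧ 1 ≤ (j : ℕ) ∧
          σᶜ = {(⟨0, by omega⟩, ⟨0, by omega⟩), (i, ⟨(j : ℕ) - 1, by omega⟩), (i, j)} := by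
  constructor
  · obtain ⟨E⟩ := homotopyEquiv_unmatchedComplex hm hn ⟨0, by omega⟩ (n - 1) (by omega)
    obtain ⟨E'⟩ := (isStarWithCells_unmatchedComplex hm hn).homotopyEquiv_wedge
    exact ⟨E.trans E'⟩
  · intro σ
    rw [critical_sequenceMatching]
    exact mem_remaining_last (by omega) (by omega)
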